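/- Let $G=(V,E)$ be a finite simple graph with vertex set $V=\{1,\dots,n\}$. For coefficients $a=(a_{ij})_{ij\in E}\in\mathbb{R}^{E}$ let $b(x)=\sum_{ij\in E}a_{ij}x_ix_j$, let $$B=\{(x,z)\in[0,1]^n\times\mathbb{R} : z=b(x)\}$$ be the graph of $b$, and let the McCormick relaxation $Q$ of $B$ be the set of all $(x,z)\in[0,1]^n\times\mathbb{R}$ for which there is $y\in[0,1]^{E}$ with $z=\sum_{ij\in E}a_{ij}y_{ij}$ and $y_{ij}\le x_i$, $y_{ij}\le x_j$, $y_{ij}\ge x_i+x_j-1$ for all $ij\in E$. An edge $ij$ is called positive if $a_{ij}>0$ and negative if $a_{ij}<0$. (1) If $a_{ij}\neq 0$ for all $ij\in E$, then $Q=\operatorname{conv}(B)$ if and only if every cycle of $G$ contains an even number of positive edges and an even number of negative edges. (2) Consequently, if $a_{ij}\ne 0$ for all $ij\in E$ and $Q=\operatorname{conv}(B)$, then $G$ is bipartite. (3) If $G$ is a forest, then $Q=\operatorname{conv}(B)$ for every choice of the coefficients $a_{ij}\in\mathbb{R}$. If $G$ is not a forest, then there are nonzero coefficients $a_{ij}$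 such that $Q\ne\operatorname{conv}(B)$. -/

import Mathlib

namespace Bilin

/-- The product `x i * x j` attached to the unordered pair `s(i, j)`. -/
def pairProd {n : ℕ} (x : Fin n → ℝ) (e : Sym2 (Fin n)) : ℝ :=
  Sym2.lift ⟨fun i j => x i * x j, fun _ _ => mul_comm _ _⟩ e

/-- The bilinear function `b(x) = ∑_{ij ∈ E} a_{ij} x_i x_j`, with one coefficient per edge of `G`. -/
def bilin {n : ℕ} (G : SimpleGraph (Fin n)) [DecidableRel G.Adj] (a : G.edgeSet → ℝ)
    (x : Fin n → ℝ) : ℝ :=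
  ∑ e : G.edgeSet, a e * pairProd x e

/-- The graph of `b` over the unit cube `[0,1]^n`. -/
def graphSet {n : ℕ} (G : SimpleGraph (Fin n)) [DecidableRel G.Adj] (a : G.edgeSet → ℝ) :
    Set ((Fin n → ℝ) × ℝ) :=
  {p | p.1 ∈ Set.Icc (0 : Fin n → ℝ) 1 ∧ p.2 = bilin G a p.1}

/-- The McCormick polytope `P(G)` in the variables `x` (one per vertex) and `y` (one per edge). -/
def polytopeP {n : ℕ} (G : SimpleGraph (Fin n)) : Set ((Fin n → ℝ) × (G.edgeSet → ℝ)) :=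
  {p | p.1 ∈ Set.Icc (0 : Fin n → ℝ) 1 ∧ p.2 ∈ Set.Icc (0 : G.edgeSet → ℝ) 1 ∧
    ∀ (i j : Fin n) (h : G.Adj i j),
      p.2 ⟨s(i, j), h⟩ ≤ p.1 i ∧ p.2 ⟨s(i, j), h⟩ ≤ p.1 j ∧
        p.1 i + p.1 j - 1 ≤ p.2 ⟨s(i, j), h⟩}

/-- The McCormick relaxation `Q(b)`. -/
def relaxQ {n : ℕ} (G : SimpleGraph (Fin n)) [DecidableRel G.Adj] (a : G.edgeSet → ℝ) :
    Set ((Fin n → ℝ) × ℝ) :=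
  {p | ∃ y : G.edgeSet → ℝ, (p.1, y) ∈ polytopeP G ∧ p.2 = ∑ e : G.edgeSet, a e * y e}

/-- The number of positive edges on a walk (each edge counted once). -/
noncomputable def numPos {n : ℕ} {G : SimpleGraph (Fin n)} (a : G.edgeSet → ℝ) {u v : Fin n}
    (w : G.Walk u v) : ℕ :=
  {e : G.edgeSet | (e : Sym2 (Fin n)) ∈ w.edges ∧ 0 < a e}.ncard

/-- The number of negative edges on a walk (each edge counted once). -/
noncomputable def numNeg {n : ℕ} {G : SimpleGraph (Fin n)} (a : G.edgeSet → ℝ) {u v : Fin n}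
    (w : G.Walk u v) : ℕ :=
  {e : G.edgeSet | (e : Sym2 (Fin n)) ∈ w.edges ∧ a e < 0}.ncard

end Bilin

/-! Cycle parity is potential theory over `ZMod 2`: every cycle has evenly many marked edges iff
some vertex labelling changes exactly along the marked edges (`forall_isCycle_even_ncard_iff`).

If the positive edges form such a cut, round each coordinate at one shared uniform threshold,
anchored at 0 or 1 according to its label. The mean is `x`, and every edge product has as its mean
the McCormick bound that minimises its term, so the lower envelope of `Q` lies in the hull
(`exists_le_mem_convexHull`). Negating `a` handles the upper envelope.

Conversely, over the cube's centre the lower envelope of `Q` meets an affine minorant of `b`. If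
that point is in the hull, the minorant touches `b` somewhere, and tightness on each edge forces 0/1
values that differ exactly across positive edges (`exists_balanced_of_relaxQ_eq`). -/

namespace SimpleGraph

/-! ### Cycle parity and vertex potentials over `ZMod 2`. -/

variable {V A : Type*} {G : SimpleGraph V}

/-- The sum of the edge weights `f` along a walk, with multiplicity. -/
def Walk.weight [AddMonoid A] (f : Sym2 V → A) {u v : V} (w : G.Walk u v) : A :=
  (w.edges.map f).sum

namespace Walk

variable (f : Sym2 V → ZMod 2) {u v w : V}

@[simp]
theorem weight_nil : (nil : G.Walk u u).weight f = 0 := rfl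

@[simp]
theorem weight_cons (h : G.Adj u v) (p : G.Walk v w) :
    (cons h p).weight f = f s(u, v) + p.weight f := by
  simp [weight]

@[simp]
theorem weight_append (p : G.Walk u v) (q : G.Walk v w) :
    (p.append q).weight f = p.weight f + q.weight f := by
  simp [weight]

@[simp]
theorem weight_reverse (p : G.Walk u v) : p.reverse.weight f = p.weight f := by
  simp [weight, List.sum_reverse]

theorem IsPath.weight_eq_of_mem_edges {p : G.Walk v u} (hp : p.IsPath) (h : s(u, v) ∈ p.edges) :
    p.weight f = f s(u, v) := by
  cases p with
  | nil => simp at h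
  | @cons _ w _ h' q =>
    rw [cons_isPath_iff] at hp
    rw [edges_cons, List.mem_cons] at h
    rcases h with h | h
    · rcases Sym2.eq_iff.1 h with ⟨h1, h2⟩ | ⟨h1, -⟩
      · subst h1
        exact absurd q.end_mem_support hp.2
      · subst h1
        rw [eq_nil_iff_nil.2 (isPath_iff_nil.1 hp.1)]
        simp [Sym2.eq_swap]
    · exact absurd (q.snd_mem_support_of_mem_edges h) hp.2

/-- If all cycles have zero weight, then shortcutting a walk to a path keeps its weight. -/
theorem weight_bypass [DecidableEq V]
    (hf : ∀ (v : V) (c : G.Walk v v), c.IsCycle → c.weight f = 0) (p : G.Walk u v) :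
    p.bypass.weight f = p.weight f := by
  induction p with
  | nil => rfl
  | @cons u w v h p ih =>
    rw [weight_cons, ← ih]
    simp only [bypass]
    split_ifs with hs
    · have hspec := congrArg (weight f) (take_spec p.bypass hs)
      rw [weight_append] at hspec
      have hpath : (p.bypass.takeUntil u hs).IsPath := (bypass_isPath p).takeUntil hs
      -- The excised closed walk is either a cycle or a single edge traversed twice, which cancels
      -- in characteristic 2.
      have key : f s(u, w) + (p.bypass.takeUntil u hs).weight f = 0 := by
        by_cases he : s(u, w) ∈ (p.bypass.takeUntil u hs).edges
        · rw [hpath.weight_eq_of_mem_edges f he]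
          exact CharTwo.add_self_eq_zero _
        · rw [← weight_cons f h]
          exact hf _ _ ((cons_isCycle_iff _ h).2 ⟨hpath, he⟩)
      rw [← hspec, ← add_assoc, key, zero_add]
    · rw [weight_cons]

theorem weight_eq_add_of_potential {σ : V → ZMod 2}
    (hσ : ∀ i j, G.Adj i j → σ i + σ j = f s(i, j)) (p : G.Walk u v) :
    p.weight f = σ u + σ v := by
  induction p with
  | nil => exact (CharTwo.add_self_eq_zero _).symm
  | @cons u w v h p ih =>
    rw [weight_cons, ih, ← hσ _ _ h]
    linear_combination CharTwo.add_self_eq_zero (σ w)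

end Walk

/-- A `ZMod 2`-weighting of the edges is balanced on all cycles iff it is induced by a labelling
of the vertices. -/
theorem forall_isCycle_weight_eq_zero_iff (f : Sym2 V → ZMod 2) :
    (∀ (v : V) (c : G.Walk v v), c.IsCycle → c.weight f = 0) ↔
      ∃ σ : V → ZMod 2, ∀ i j, G.Adj i j → σ i + σ j = f s(i, j) := by
  classical
  constructor
  · intro hf
    have hr : ∀ v, G.Reachable (G.connectedComponentMk v).out v := fun v =>
      ConnectedComponent.exact (Quot.out_eq _)
    refine ⟨fun v => (hr v).some.weight f, fun i j h => ?_⟩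
    have hij : G.connectedComponentMk i = G.connectedComponentMk j :=
      ConnectedComponent.sound h.reachable
    -- The roots are generalised because the representatives chosen for `i` and `j` agree only
    -- propositionally.
    have key : ∀ (r s : V) (p : G.Walk r i) (q : G.Walk s j), r = s →
        p.weight f + q.weight f = f s(i, j) := by
      rintro r _ p q rfl
      have hc := Walk.weight_bypass f hf ((p.append (Walk.cons h .nil)).append q.reverse)
      rw [Walk.eq_nil_iff_nil.2 (Walk.isPath_iff_nil.1 (Walk.bypass_isPath _))] at hc
      simp only [Walk.weight_nil, Walk.weight_append, Walk.weight_cons, Walk.weight_reverse] at hc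
      rw [← sub_eq_zero, CharTwo.sub_eq_add]
      linear_combination -hc
    exact key _ _ _ _ (by rw [hij])
  · rintro ⟨σ, hσ⟩ v c -
    rw [Walk.weight_eq_add_of_potential f hσ]
    exact CharTwo.add_self_eq_zero _

open Classical in
/-- The indicator of an edge predicate, as a `ZMod 2`-valued weight. -/
noncomputable def parityWeight (P : G.edgeSet → Prop) (e : Sym2 V) : ZMod 2 :=
  if ∃ h : e ∈ G.edgeSet, P ⟨e, h⟩ then 1 else 0

theorem parityWeight_of_pos {P : G.edgeSet → Prop} {e : G.edgeSet} (h : P e) :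
    parityWeight P e = 1 := if_pos ⟨e.2, h⟩

theorem parityWeight_of_neg {P : G.edgeSet → Prop} {e : G.edgeSet} (h : ¬ P e) :
    parityWeight P e = 0 := if_neg fun ⟨_, h'⟩ => h h'

/-- The weight of a trail under an indicator weight is the parity of the number of marked edges. -/
theorem Walk.IsTrail.weight_parityWeight (P : G.edgeSet → Prop) {u v : V} {w : G.Walk u v}
    (hw : w.IsTrail) :
    w.weight (parityWeight P) = ({e : G.edgeSet | (e : Sym2 V) ∈ w.edges ∧ P e}.ncard : ZMod 2) := by
  classical
  have hset : (Subtype.val '' {e : G.edgeSet | (e : Sym2 V) ∈ w.edges ∧ P e}) =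
      (w.edges.toFinset.filter fun e => ∃ h : e ∈ G.edgeSet, P ⟨e, h⟩ : Finset (Sym2 V)) := by
    ext e
    constructor
    · rintro ⟨e, ⟨h1, h2⟩, rfl⟩
      simpa [h1] using h2
    · intro h
      obtain ⟨h1, h2, h3⟩ := by simpa using h
      exact ⟨⟨e, h2⟩, ⟨h1, h3⟩, rfl⟩
  rw [← Set.ncard_image_of_injective _ Subtype.val_injective, hset, Set.ncard_coe_finset,
    Finset.card_filter, Nat.cast_sum, Walk.weight, ← List.sum_toFinset _ hw.edges_nodup]
  exact Finset.sum_congr rfl fun e _ => by simp only [parityWeight]; split_ifs <;> simp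

/-- Every cycle contains an even number of marked edges iff the vertices have a labelling that
changes exactly along the marked edges. -/
theorem forall_isCycle_even_ncard_iff (P : G.edgeSet → Prop) :
    (∀ (v : V) (c : G.Walk v v), c.IsCycle →
        Even {e : G.edgeSet | (e : Sym2 V) ∈ c.edges ∧ P e}.ncard) ↔
      ∃ σ : V → ZMod 2, ∀ i j, G.Adj i j → σ i + σ j = parityWeight P s(i, j) := by
  rw [← forall_isCycle_weight_eq_zero_iff]
  refine forall_congr' fun v => forall_congr' fun c => forall_congr' fun hc => ?_
  rw [hc.isTrail.weight_parityWeight, ZMod.natCast_eq_zero_iff_even]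

end SimpleGraph

/-! ### Affine edge bounds and the inclusion of the hull in the relaxation. -/

namespace Bilin

open MeasureTheory Set SimpleGraph

variable {n : ℕ} {G : SimpleGraph (Fin n)} {a : G.edgeSet → ℝ}

@[simp]
theorem pairProd_mk (x : Fin n → ℝ) (i j : Fin n) : pairProd x s(i, j) = x i * x j := rfl

/-- The sum `x i + x j` attached to the unordered pair `s(i, j)`. -/
def pairSum (x : Fin n → ℝ) (e : Sym2 (Fin n)) : ℝ :=
  Sym2.lift ⟨fun i j => x i + x j, fun _ _ => add_comm _ _⟩ e

@[simp]
theorem pairSum_mk (x : Fin n → ℝ) (i j : Fin n) : pairSum x s(i, j) = x i + x j := rfl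

theorem pairSum_combo (x y : Fin n → ℝ) (α β : ℝ) (e : Sym2 (Fin n)) :
    pairSum (α • x + β • y) e = α * pairSum x e + β * pairSum y e := by
  induction e with
  | _ i j => simp only [pairSum_mk, Pi.add_apply, Pi.smul_apply, smul_eq_mul]; ring

theorem convex_polytopeP : Convex ℝ (polytopeP G) := by
  rintro ⟨x, y⟩ ⟨hx, hy, h⟩ ⟨x', y'⟩ ⟨hx', hy', h'⟩ α β hα hβ hαβ
  refine ⟨convex_Icc _ _ hx hx' hα hβ hαβ, convex_Icc _ _ hy hy' hα hβ hαβ, fun i j hij => ?_⟩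
  obtain ⟨h1, h2, h3⟩ := h i j hij
  obtain ⟨h1', h2', h3'⟩ := h' i j hij
  simp only [Prod.fst_add, Prod.snd_add, Prod.smul_fst, Prod.smul_snd, Pi.add_apply,
    Pi.smul_apply, smul_eq_mul] at *
  refine ⟨by gcongr, by gcongr, ?_⟩
  have e1 := mul_le_mul_of_nonneg_left h3 hα
  have e2 := mul_le_mul_of_nonneg_left h3' hβ
  linarith

open Classical in
/-- The affine lower bound of `x i * x j` (for positive edges) or upper bound (otherwise) that is
tight exactly at the vertices with differing, respectively equal, coordinates. -/
noncomputable def edgeBound (a : G.edgeSet → ℝ) (x : Fin n → ℝ) (e : G.edgeSet) : ℝ :=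
  if 0 < a e then (pairSum x e - 1) / 2 else pairSum x e / 2

theorem edgeBound_combo (x y : Fin n → ℝ) {α β : ℝ} (h : α + β = 1) (e : G.edgeSet) :
    edgeBound a (α • x + β • y) e = α * edgeBound a x e + β * edgeBound a y e := by
  unfold edgeBound
  split_ifs
  · rw [pairSum_combo]; linear_combination (1 / 2) * h
  · rw [pairSum_combo]; ring

/-- Twice the gap between product and bound is `x i * x j + (1 - x i) * (1 - x j)` on a positive
edge, and `-(x i * (1 - x j) + (1 - x i) * x j)` otherwise. -/
theorem edgeBound_le {x : Fin n → ℝ} (hx : x ∈ Icc (0 : Fin n → ℝ) 1) (e : G.edgeSet) :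
    a e * edgeBound a x e ≤ a e * pairProd x e := by
  obtain ⟨e, he⟩ := e
  induction e with
  | _ i j =>
    have hi0 : 0 ≤ x i := hx.1 i
    have hj0 : 0 ≤ x j := hx.1 j
    have hi1 : 0 ≤ 1 - x i := sub_nonneg.2 (hx.2 i)
    have hj1 : 0 ≤ 1 - x j := sub_nonneg.2 (hx.2 j)
    unfold edgeBound
    split_ifs with hpos
    · refine mul_le_mul_of_nonneg_left ?_ hpos.le
      simp only [pairSum_mk, pairProd_mk]
      nlinarith [mul_nonneg hi0 hj0, mul_nonneg hi1 hj1]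
    · refine mul_le_mul_of_nonpos_left ?_ (not_lt.1 hpos)
      simp only [pairSum_mk, pairProd_mk]
      nlinarith [mul_nonneg hi0 hj1, mul_nonneg hi1 hj0]

variable [DecidableRel G.Adj]

theorem convex_relaxQ : Convex ℝ (relaxQ G a) := by
  rintro ⟨x, z⟩ ⟨y, hy, hz⟩ ⟨x', z'⟩ ⟨y', hy', hz'⟩ α β hα hβ hαβ
  refine ⟨α • y + β • y', convex_polytopeP hy hy' hα hβ hαβ, ?_⟩
  simp only [Prod.snd_add, Prod.smul_snd, smul_eq_mul, Pi.add_apply, Pi.smul_apply] at *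
  rw [hz, hz', Finset.mul_sum, Finset.mul_sum, ← Finset.sum_add_distrib]
  exact Finset.sum_congr rfl fun e _ => by ring

theorem graphSet_subset_relaxQ : graphSet G a ⊆ relaxQ G a := by
  rintro ⟨x, z⟩ ⟨⟨h0, h1⟩, hz⟩
  have h0 : ∀ i, 0 ≤ x i := h0
  have h1 : ∀ i, x i ≤ 1 := h1
  refine ⟨fun e => pairProd x e, ⟨⟨h0, h1⟩, ⟨?_, ?_⟩, fun i j _ => ⟨?_, ?_, ?_⟩⟩, hz⟩
  · rintro ⟨e, he⟩
    induction e with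
    | _ i j => exact mul_nonneg (h0 i) (h0 j)
  · rintro ⟨e, he⟩
    induction e with
    | _ i j => exact mul_le_one₀ (h1 i) (h0 j) (h1 j)
  · exact mul_le_of_le_one_right (h0 i) (h1 j)
  · exact mul_le_of_le_one_left (h0 j) (h1 i)
  · change x i + x j - 1 ≤ x i * x j
    nlinarith [mul_nonneg (sub_nonneg.2 (h1 i)) (sub_nonneg.2 (h1 j))]

theorem convexHull_graphSet_subset_relaxQ : convexHull ℝ (graphSet G a) ⊆ relaxQ G a :=
  convexHull_min graphSet_subset_relaxQ convex_relaxQ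

/-! ### Changing the sign of the coefficients -/

theorem mem_relaxQ_neg {x : Fin n → ℝ} {z : ℝ} (h : (x, z) ∈ relaxQ G a) :
    (x, -z) ∈ relaxQ G (-a) := by
  obtain ⟨y, hy, hz⟩ := h
  exact ⟨y, hy, by simpa using hz⟩

theorem mem_convexHull_graphSet_neg {x : Fin n → ℝ} {z : ℝ}
    (h : (x, z) ∈ convexHull ℝ (graphSet G a)) :
    (x, -z) ∈ convexHull ℝ (graphSet G (-a)) := by
  let T : (Fin n → ℝ) × ℝ →ₗ[ℝ] (Fin n → ℝ) × ℝ := LinearMap.id.prodMap (-LinearMap.id)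
  have hsub : convexHull ℝ (graphSet G a) ⊆ T ⁻¹' convexHull ℝ (graphSet G (-a)) :=
    convexHull_min (fun p hp => subset_convexHull ℝ _ ⟨hp.1, by
      simp only [T, bilin, LinearMap.prodMap_apply, LinearMap.neg_apply, LinearMap.id_apply, hp.2,
        Pi.neg_apply, neg_mul, Finset.sum_neg_distrib]⟩)
      ((convex_convexHull ℝ _).linear_preimage T)
  exact hsub h

theorem relaxQ_eq_convexHull_neg (h : relaxQ G a = convexHull ℝ (graphSet G a)) :
    relaxQ G (-a) = convexHull ℝ (graphSet G (-a)) := by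
  refine Subset.antisymm (fun ⟨x, z⟩ hp => ?_) convexHull_graphSet_subset_relaxQ
  have h1 := mem_relaxQ_neg hp
  rw [neg_neg, h] at h1
  simpa using mem_convexHull_graphSet_neg h1

/-! ### Threshold rounding -/

/-- The interval of thresholds at which a coordinate with value `r` is rounded up, anchored at `0`
or at `1` depending on the label `s`. -/
def thresholdSet (s : ZMod 2) (r : ℝ) : Set ℝ := if s = 0 then Ioc 0 r else Ioc (1 - r) 1

/-- Rounding of the point `x` at threshold `t`, with labels `σ`. -/
noncomputable def rounding (σ : Fin n → ZMod 2) (x : Fin n → ℝ) (t : ℝ) (i : Fin n) : ℝ :=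
  (thresholdSet (σ i) (x i)).indicator 1 t

theorem measurableSet_thresholdSet (s : ZMod 2) (r : ℝ) : MeasurableSet (thresholdSet s r) := by
  unfold thresholdSet; split_ifs <;> exact measurableSet_Ioc

theorem thresholdSet_subset {s : ZMod 2} {r : ℝ} (h1 : r ≤ 1) :
    thresholdSet s r ⊆ Ioc 0 1 := by
  unfold thresholdSet
  split_ifs
  · exact Ioc_subset_Ioc_right h1
  · exact Ioc_subset_Ioc_left (by linarith)

theorem rounding_eq_zero_or_one (σ : Fin n → ZMod 2) (x : Fin n → ℝ) (t : ℝ) (i : Fin n) :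
    rounding σ x t i = 0 ∨ rounding σ x t i = 1 := by
  by_cases h : t ∈ thresholdSet (σ i) (x i) <;> simp [rounding, h]

theorem rounding_mul_rounding (σ : Fin n → ZMod 2) (x : Fin n → ℝ) (t : ℝ) (i j : Fin n) :
    rounding σ x t i * rounding σ x t j =
      (thresholdSet (σ i) (x i) ∩ thresholdSet (σ j) (x j)).indicator 1 t := by
  rw [inter_indicator_one]; rfl

theorem volume_real_thresholdSet (s : ZMod 2) {r : ℝ} (h0 : 0 ≤ r) :
    volume.real (thresholdSet s r) = r := by
  unfold thresholdSet
  split_ifs <;> simp [h0]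

/-- Intervals anchored at the same end are nested; those anchored at opposite ends overlap only in
the excess of their total length over 1. -/
theorem volume_real_thresholdSet_inter {s s' : ZMod 2} {r r' : ℝ} (h0 : 0 ≤ r) (h0' : 0 ≤ r')
    (h1 : r ≤ 1) (h1' : r' ≤ 1) :
    volume.real (thresholdSet s r ∩ thresholdSet s' r') =
      if s + s' = 0 then min r r' else max (r + r' - 1) 0 := by
  have hcases : ∀ u : ZMod 2, u = 0 ∨ u = 1 := by decide
  rcases hcases s with rfl | rfl <;> rcases hcases s' with rfl | rfl
  · simp [thresholdSet, Ioc_inter_Ioc, h0, h0']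
  · simp only [thresholdSet, Ioc_inter_Ioc, ↓reduceIte, one_ne_zero, zero_add,
      Real.volume_real_Ioc]
    rw [max_eq_right (sub_nonneg.2 h1'), min_eq_left h1]
    congr 1; ring
  · simp only [thresholdSet, Ioc_inter_Ioc, ↓reduceIte, one_ne_zero, add_zero,
      Real.volume_real_Ioc]
    rw [max_eq_left (sub_nonneg.2 h1), min_eq_right h1']
    congr 1; ring
  · have h2 : (1 : ZMod 2) + 1 = 0 := by decide
    simp only [thresholdSet, Ioc_inter_Ioc, h2, ↓reduceIte, one_ne_zero, Real.volume_real_Ioc,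
      min_self]
    rcases le_total r r' with h | h
    · rw [min_eq_left h, max_eq_left (sub_le_sub_left h 1), sub_sub_cancel, max_eq_left h0]
    · rw [min_eq_right h, max_eq_right (sub_le_sub_left h 1), sub_sub_cancel, max_eq_left h0']

theorem setIntegral_Ioc_indicator_one {S : Set ℝ} (hS : MeasurableSet S) (hS' : S ⊆ Ioc 0 1) :
    ∫ t in Ioc (0 : ℝ) 1, S.indicator (1 : ℝ → ℝ) t = volume.real S := by
  rw [integral_indicator_one hS, measureReal_restrict_apply hS, inter_eq_left.2 hS']

section Rounding

variable (σ : Fin n → ZMod 2) {x : Fin n → ℝ}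

theorem integrable_rounding (x : Fin n → ℝ) (i : Fin n) :
    IntegrableOn (fun t => rounding σ x t i) (Ioc 0 1) :=
  (integrable_const (1 : ℝ)).indicator (measurableSet_thresholdSet _ _)

theorem integrable_pairProd_rounding (x : Fin n → ℝ) (e : Sym2 (Fin n)) :
    IntegrableOn (fun t => pairProd (rounding σ x t) e) (Ioc 0 1) := by
  induction e with
  | _ i j =>
    simp only [pairProd_mk, rounding_mul_rounding]
    exact (integrable_const (1 : ℝ)).indicator
      ((measurableSet_thresholdSet _ _).inter (measurableSet_thresholdSet _ _))

theorem setIntegral_rounding (hx : x ∈ Icc (0 : Fin n → ℝ) 1) (i : Fin n) :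
    ∫ t in Ioc (0 : ℝ) 1, rounding σ x t i = x i :=
  (setIntegral_Ioc_indicator_one (measurableSet_thresholdSet _ _)
    (thresholdSet_subset (hx.2 i))).trans (volume_real_thresholdSet _ (hx.1 i))

theorem setIntegral_pairProd_rounding (hx : x ∈ Icc (0 : Fin n → ℝ) 1) (i j : Fin n) :
    ∫ t in Ioc (0 : ℝ) 1, pairProd (rounding σ x t) s(i, j) =
      if σ i + σ j = 0 then min (x i) (x j) else max (x i + x j - 1) 0 := by
  simp only [pairProd_mk, rounding_mul_rounding]
  rw [setIntegral_Ioc_indicator_one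
    ((measurableSet_thresholdSet _ _).inter (measurableSet_thresholdSet _ _))
    (inter_subset_left.trans (thresholdSet_subset (hx.2 i))),
    volume_real_thresholdSet_inter (hx.1 i) (hx.1 j) (hx.2 i) (hx.2 j)]

/-- The expected value of threshold rounding lies in the convex hull of the graph. -/
theorem mem_convexHull_graphSet_of_rounding (hx : x ∈ Icc (0 : Fin n → ℝ) 1) :
    (x, ∑ e : G.edgeSet, a e * ∫ t in Ioc (0 : ℝ) 1, pairProd (rounding σ x t) e) ∈
      convexHull ℝ (graphSet G a) := by
  -- Only the finitely many graph points over cube vertices are used, so that the hull is closed, as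
  -- `integral_mem` requires.
  let S : Set ((Fin n → ℝ) × ℝ) :=
    (fun y => (y, bilin G a y)) '' {y : Fin n → ℝ | ∀ i, y i ∈ ({0, 1} : Set ℝ)}
  have hfin : {y : Fin n → ℝ | ∀ i, y i ∈ ({0, 1} : Set ℝ)}.Finite :=
    (Set.Finite.pi' fun _ => (finite_singleton (1 : ℝ)).insert 0)
  have hSsub : S ⊆ graphSet G a := by
    rintro _ ⟨y, hy, rfl⟩
    refine ⟨⟨fun i => ?_, fun i => ?_⟩, rfl⟩ <;> rcases hy i with h | (h : y i = 1) <;>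
      simp [h]
  refine convexHull_mono hSsub ?_
  have : IsProbabilityMeasure (volume.restrict (Ioc (0 : ℝ) 1)) := ⟨by simp⟩
  have hb : IntegrableOn (fun t => bilin G a (rounding σ x t)) (Ioc 0 1) :=
    integrable_finsetSum _ fun e _ => (integrable_pairProd_rounding σ x e).const_mul _
  have hr : IntegrableOn (fun t => rounding σ x t) (Ioc 0 1) :=
    Integrable.of_eval (integrable_rounding σ x)
  have hmem := (convex_convexHull ℝ S).integral_mem ((hfin.image _).isClosed_convexHull ℝ)
    (μ := volume.restrict (Ioc (0 : ℝ) 1))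
    (f := fun t => (rounding σ x t, bilin G a (rounding σ x t)))
    (Filter.Eventually.of_forall fun t => subset_convexHull ℝ S
      ⟨_, fun i => rounding_eq_zero_or_one σ x t i, rfl⟩) (hr.prodMk hb)
  rw [integral_pair hr hb] at hmem
  convert hmem using 2
  · ext i
    rw [eval_integral (integrable_rounding σ x), setIntegral_rounding σ hx]
  · simp only [bilin]
    rw [integral_finsetSum _ fun (e : G.edgeSet) _ =>
      (integrable_pairProd_rounding σ x e).const_mul (a e)]
    simp only [integral_const_mul]

end Rounding

/-- If the positive edges form a cut, the lower McCormick bound is attained on the convex hull. -/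
theorem exists_le_mem_convexHull {σ : Fin n → ZMod 2}
    (hσ : ∀ i j, G.Adj i j → σ i + σ j = parityWeight (fun e : G.edgeSet => 0 < a e) s(i, j))
    {x : Fin n → ℝ} {z : ℝ} (h : (x, z) ∈ relaxQ G a) :
    ∃ z' ≤ z, (x, z') ∈ convexHull ℝ (graphSet G a) := by
  obtain ⟨y, ⟨hx, hy, hxy⟩, rfl⟩ := h
  refine ⟨_, ?_, mem_convexHull_graphSet_of_rounding σ hx⟩
  refine Finset.sum_le_sum fun e _ => ?_
  obtain ⟨e, he⟩ := e
  induction e with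
  | _ i j =>
    obtain ⟨h1, h2, h3⟩ := hxy i j he
    have h4 := hy.1 ⟨s(i, j), he⟩
    have hs := hσ i j he
    simp only [setIntegral_pairProd_rounding σ hx]
    by_cases hpos : 0 < a ⟨s(i, j), he⟩
    · rw [hs, parityWeight_of_pos (e := ⟨s(i, j), he⟩) hpos, if_neg one_ne_zero]
      exact mul_le_mul_of_nonneg_left (max_le h3 h4) hpos.le
    · rw [hs, parityWeight_of_neg (e := ⟨s(i, j), he⟩) hpos, if_pos rfl]
      exact mul_le_mul_of_nonpos_left (le_min h1 h2) (not_lt.1 hpos)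

theorem relaxQ_eq_convexHull_of_balanced {σ τ : Fin n → ZMod 2}
    (hσ : ∀ i j, G.Adj i j → σ i + σ j = parityWeight (fun e : G.edgeSet => 0 < a e) s(i, j))
    (hτ : ∀ i j, G.Adj i j → τ i + τ j = parityWeight (fun e : G.edgeSet => a e < 0) s(i, j)) :
    relaxQ G a = convexHull ℝ (graphSet G a) := by
  refine Subset.antisymm (fun ⟨x, z⟩ hp => ?_) convexHull_graphSet_subset_relaxQ
  obtain ⟨z₁, hz₁, h₁⟩ := exists_le_mem_convexHull hσ hp
  obtain ⟨z₂, hz₂, h₂⟩ := exists_le_mem_convexHull (a := -a) (σ := τ)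
    (by simpa only [Pi.neg_apply, Left.neg_pos_iff] using hτ) (mem_relaxQ_neg hp)
  replace h₂ := mem_convexHull_graphSet_neg h₂
  rw [neg_neg] at h₂
  -- The fibre of the hull over `x` is an interval, so it contains everything between the two
  -- envelope points.
  have hconv : Convex ℝ {w : ℝ | (x, w) ∈ convexHull ℝ (graphSet G a)} := by
    intro w hw w' hw' α β hα hβ hαβ
    have := convex_convexHull ℝ (graphSet G a) hw hw' hα hβ hαβ
    rwa [Prod.smul_mk, Prod.smul_mk, Prod.mk_add_mk, ← add_smul, hαβ, one_smul] at this
  exact hconv.ordConnected.out h₁ h₂ ⟨hz₁, by linarith⟩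

/-! ### The centre of the cube -/

/-- At the centre the McCormick constraints on each edge reduce to `0 ≤ y ≤ 1 / 2`, and the edge
bound is one of these endpoints. -/
theorem centre_mem_relaxQ :
    ((fun _ => 1 / 2 : Fin n → ℝ), ∑ e, a e * edgeBound a (fun _ => 1 / 2) e) ∈ relaxQ G a := by
  have hval : ∀ e : G.edgeSet, edgeBound a (fun _ => 1 / 2) e = 0 ∨
      edgeBound a (fun _ => 1 / 2) e = 1 / 2 := by
    rintro ⟨e, he⟩
    induction e with
    | _ i j => unfold edgeBound; split_ifs <;> norm_num [pairSum_mk]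
  refine ⟨edgeBound a (fun _ => 1 / 2), ⟨⟨fun _ => ?_, fun _ => ?_⟩, ⟨fun e => ?_, fun e => ?_⟩,
    fun i j h => ?_⟩, rfl⟩
  · norm_num
  · norm_num
  · rcases hval e with h | h <;> norm_num [h]
  · rcases hval e with h | h <;> norm_num [h]
  · rcases hval ⟨s(i, j), h⟩ with h | h <;> norm_num [h]

/-- If the centre of the lower McCormick envelope lies in the convex hull of the graph, some point
of the cube attains all edge bounds simultaneously. -/
theorem exists_edgeBound_eq
    (h : ((fun _ => 1 / 2 : Fin n → ℝ), ∑ e, a e * edgeBound a (fun _ => 1 / 2) e) ∈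
      convexHull ℝ (graphSet G a)) :
    ∃ x ∈ Icc (0 : Fin n → ℝ) 1, ∀ e, a e * edgeBound a x e = a e * pairProd x e := by
  by_contra! hne
  -- The strict epigraph of the affine minorant: it would contain the whole graph, yet the given
  -- point lies on its boundary.
  let H : Set ((Fin n → ℝ) × ℝ) := {p | ∑ e, a e * edgeBound a p.1 e < p.2}
  have hH : Convex ℝ H := by
    rintro ⟨x, z⟩ hx ⟨y, w⟩ hy α β hα hβ hαβ
    simp only [H, mem_ofPred_eq, Prod.smul_mk, Prod.mk_add_mk, smul_eq_mul] at *
    simp only [edgeBound_combo x y hαβ]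
    have hsum : ∑ e, a e * (α * edgeBound a x e + β * edgeBound a y e) =
        α * ∑ e, a e * edgeBound a x e + β * ∑ e, a e * edgeBound a y e := by
      rw [Finset.mul_sum, Finset.mul_sum, ← Finset.sum_add_distrib]
      exact Finset.sum_congr rfl fun e _ => by ring
    rw [hsum]
    rcases hα.eq_or_lt with rfl | hα'
    · obtain rfl : β = 1 := by linarith
      simpa using hy
    · have := mul_lt_mul_of_pos_left hx hα'
      have := mul_le_mul_of_nonneg_left hy.le hβ
      linarith
  have hsub : graphSet G a ⊆ H := by
    rintro ⟨x, z⟩ ⟨hx, hz⟩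
    obtain ⟨e, he⟩ := hne x hx
    refine lt_of_lt_of_eq ?_ hz.symm
    exact Finset.sum_lt_sum (fun e _ => edgeBound_le hx e)
      ⟨e, Finset.mem_univ _, lt_of_le_of_ne (edgeBound_le hx e) he⟩
  have hmem := convexHull_min hsub hH h
  simp only [H, mem_ofPred_eq, lt_irrefl] at hmem

/-- If the relaxation is exact, the positive edges form a cut. -/
theorem exists_balanced_of_relaxQ_eq (ha : ∀ e, a e ≠ 0)
    (h : relaxQ G a = convexHull ℝ (graphSet G a)) :
    ∃ σ : Fin n → ZMod 2, ∀ i j, G.Adj i j →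
      σ i + σ j = parityWeight (fun e : G.edgeSet => 0 < a e) s(i, j) := by
  classical
  obtain ⟨x, hx, hxe⟩ := exists_edgeBound_eq (h ▸ centre_mem_relaxQ (G := G) (a := a))
  refine ⟨fun i => if x i = 1 then 1 else 0, fun i j hij => ?_⟩
  have hi0 : 0 ≤ x i := hx.1 i
  have hj0 : 0 ≤ x j := hx.1 j
  have hi1 : 0 ≤ 1 - x i := sub_nonneg.2 (hx.2 i)
  have hj1 : 0 ≤ 1 - x j := sub_nonneg.2 (hx.2 j)
  have heq := mul_left_cancel₀ (ha ⟨s(i, j), hij⟩) (hxe ⟨s(i, j), hij⟩)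
  unfold edgeBound at heq
  split_ifs at heq with hpos
  · rw [parityWeight_of_pos (e := ⟨s(i, j), hij⟩) hpos]
    simp only [pairSum_mk, pairProd_mk] at heq
    -- Tightness makes a sum of two nonnegative products vanish, hence each product.
    have h1 : x i * x j = 0 := by nlinarith [mul_nonneg hi0 hj0, mul_nonneg hi1 hj1]
    have h2 : (1 - x i) * (1 - x j) = 0 := by nlinarith [mul_nonneg hi0 hj0, mul_nonneg hi1 hj1]
    rcases mul_eq_zero.1 h1 with h | h
    · rw [h, sub_zero, one_mul] at h2
      simp [h, (sub_eq_zero.1 h2).symm]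
    · rw [h, sub_zero, mul_one] at h2
      simp [h, (sub_eq_zero.1 h2).symm]
  · rw [parityWeight_of_neg (e := ⟨s(i, j), hij⟩) hpos]
    simp only [pairSum_mk, pairProd_mk] at heq
    have h1 : x i * (1 - x j) = 0 := by nlinarith [mul_nonneg hi0 hj1, mul_nonneg hi1 hj0]
    have h2 : (1 - x i) * x j = 0 := by nlinarith [mul_nonneg hi0 hj1, mul_nonneg hi1 hj0]
    have hxx : x i = x j := by linarith
    simp only [hxx]
    exact CharTwo.add_self_eq_zero _

/-! ### The cycle criterion, bipartiteness and forests. -/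

theorem relaxQ_eq_convexHull_of_even
    (h : ∀ (v : Fin n) (c : G.Walk v v), c.IsCycle → Even (numPos a c) ∧ Even (numNeg a c)) :
    relaxQ G a = convexHull ℝ (graphSet G a) := by
  obtain ⟨σ, hσ⟩ := (forall_isCycle_even_ncard_iff _).1 fun v c hc => (h v c hc).1
  obtain ⟨τ, hτ⟩ := (forall_isCycle_even_ncard_iff _).1 fun v c hc => (h v c hc).2
  exact relaxQ_eq_convexHull_of_balanced hσ hτ

theorem exists_balanced_neg_of_relaxQ_eq (ha : ∀ e, a e ≠ 0)
    (h : relaxQ G a = convexHull ℝ (graphSet G a)) :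
    ∃ τ : Fin n → ZMod 2, ∀ i j, G.Adj i j →
      τ i + τ j = parityWeight (fun e : G.edgeSet => a e < 0) s(i, j) := by
  simpa only [Pi.neg_apply, Left.neg_pos_iff] using
    exists_balanced_of_relaxQ_eq (a := -a) (fun e => neg_ne_zero.2 (ha e))
      (relaxQ_eq_convexHull_neg h)

theorem relaxQ_eq_convexHull_iff (ha : ∀ e, a e ≠ 0) :
    relaxQ G a = convexHull ℝ (graphSet G a) ↔
      ∀ (v : Fin n) (c : G.Walk v v), c.IsCycle → Even (numPos a c) ∧ Even (numNeg a c) :=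
  ⟨fun h v c hc =>
    ⟨(forall_isCycle_even_ncard_iff _).2 (exists_balanced_of_relaxQ_eq ha h) v c hc,
      (forall_isCycle_even_ncard_iff _).2 (exists_balanced_neg_of_relaxQ_eq ha h) v c hc⟩,
    relaxQ_eq_convexHull_of_even⟩

/-- Each edge is exactly one of positive or negative, so the sum of the two labellings changes along
every edge. -/
theorem isBipartite_of_relaxQ_eq (ha : ∀ e, a e ≠ 0)
    (h : relaxQ G a = convexHull ℝ (graphSet G a)) : G.IsBipartite := by
  obtain ⟨σ, hσ⟩ := exists_balanced_of_relaxQ_eq ha h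
  obtain ⟨τ, hτ⟩ := exists_balanced_neg_of_relaxQ_eq ha h
  refine ⟨Coloring.mk (fun i => (σ i + τ i : ZMod 2)) fun {i j} hij heq => ?_⟩
  have hsum : (σ i + σ j) + (τ i + τ j) = 0 := by
    have heq' : σ i + τ i = σ j + τ j := heq
    linear_combination heq' + CharTwo.add_self_eq_zero (σ j + τ j)
  rw [hσ i j hij, hτ i j hij] at hsum
  rcases (ha ⟨s(i, j), hij⟩).lt_or_gt with hlt | hgt
  · rw [parityWeight_of_neg (P := fun e => 0 < a e) (e := ⟨s(i, j), hij⟩) hlt.not_gt,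
      parityWeight_of_pos (P := fun e => a e < 0) (e := ⟨s(i, j), hij⟩) hlt, zero_add] at hsum
    exact one_ne_zero hsum
  · rw [parityWeight_of_pos (P := fun e => 0 < a e) (e := ⟨s(i, j), hij⟩) hgt,
      parityWeight_of_neg (P := fun e => a e < 0) (e := ⟨s(i, j), hij⟩) hgt.not_gt, add_zero] at hsum
    exact one_ne_zero hsum

theorem exists_relaxQ_ne_convexHull (hG : ¬ G.IsAcyclic) :
    ∃ a : G.edgeSet → ℝ, (∀ e, a e ≠ 0) ∧ relaxQ G a ≠ convexHull ℝ (graphSet G a) := by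
  classical
  obtain ⟨v, c, hc⟩ : ∃ (v : Fin n) (c : G.Walk v v), c.IsCycle := by
    simpa [IsAcyclic] using hG
  obtain ⟨e, he⟩ := List.exists_mem_of_ne_nil c.edges fun h =>
    hc.ne_nil (Walk.edges_eq_nil.1 h).eq_nil
  have heG := c.edges_subset_edgeSet he
  -- Exactly one edge of the cycle is made positive, an odd number.
  let a : G.edgeSet → ℝ := fun e' => if e' = ⟨e, heG⟩ then 1 else -1
  have ha : ∀ e', a e' ≠ 0 := fun e' => by simp only [a]; split_ifs <;> norm_num
  have hpos : ∀ e', 0 < a e' ↔ e' = ⟨e, heG⟩ := fun e' => by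
    simp only [a]; split_ifs with h <;> simp [h]
  refine ⟨a, ha, fun h => ?_⟩
  have hev := ((relaxQ_eq_convexHull_iff ha).1 h v c hc).1
  have hset : {e' : G.edgeSet | (e' : Sym2 (Fin n)) ∈ c.edges ∧ 0 < a e'} = {⟨e, heG⟩} := by
    ext e'
    simp only [hpos, mem_ofPred_eq, mem_singleton_iff, and_iff_right_iff_imp]
    rintro rfl
    exact he
  rw [numPos, hset, ncard_singleton] at hev
  exact Nat.not_even_one hev

end Bilin

theorem theorem4 (n : ℕ) (G : SimpleGraph (Fin n)) [DecidableRel G.Adj] :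
    (∀ a : G.edgeSet → ℝ, (∀ e, a e ≠ 0) →
      (Bilin.relaxQ G a = convexHull ℝ (Bilin.graphSet G a) ↔
        ∀ (v : Fin n) (c : G.Walk v v), c.IsCycle →
          Even (Bilin.numPos a c) ∧ Even (Bilin.numNeg a c))) ∧
    (∀ a : G.edgeSet → ℝ, (∀ e, a e ≠ 0) →
      Bilin.relaxQ G a = convexHull ℝ (Bilin.graphSet G a) → G.IsBipartite) ∧
    (G.IsAcyclic → ∀ a : G.edgeSet → ℝ,
      Bilin.relaxQ G a = convexHull ℝ (Bilin.graphSet G a)) ∧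
    (¬ G.IsAcyclic → ∃ a : G.edgeSet → ℝ, (∀ e, a e ≠ 0) ∧
      Bilin.relaxQ G a ≠ convexHull ℝ (Bilin.graphSet G a)) := by
  exact ⟨fun _ ha => Bilin.relaxQ_eq_convexHull_iff ha,
    fun _ ha h => Bilin.isBipartite_of_relaxQ_eq ha h,
    fun hG _ => Bilin.relaxQ_eq_convexHull_of_even fun _ c hc => absurd hc (hG c),
    fun hG => Bilin.exists_relaxQ_ne_convexHull hG⟩
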